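/- **Proposition (Naturality).** Let $k=\mathbb F_q$ be a finite field with $q$ elements, $K=\overline{\mathbb F}_q$ an algebraic closure and $\sigma:\operatorname{Spec}K\to\operatorname{Spec}K$ the automorphism induced by $a\mapsto a^q$. Let $X$ be a smooth projective geometrically connected curve over $k$ and $G$ a smooth affine group scheme over $k$ (for example a semisimple algebraic group). Put $X_K=X\times_k\operatorname{Spec}K$. Let $\mathrm{Bun}=\mathrm{Bun}_{G,X,K}$ be the moduli stack whose groupoid of points over a $K$-scheme $U$ is the groupoid of (étale-locally trivial) principal $G$-bundles over $X_K\times_K U$, and for every connected component $\theta$ of $\mathrm{Bun}$ let $\mathrm{Bun}^\theta\subset\mathrm{Bun}$ be the corresponding substack. A principal $G$-bundle on a stack $\mathcal Y$ is a morphism $\mathcal Y\to BG$ to the classifying stack, and pullback is composition. The universal bundle $\mathcal P^{univ}_\theta$ on $X_K\times_K\mathrm{Bun}^\theta$ is the one whose restriction along the morphism $U\to X_K\times_K\mathrm{Bun}^\theta$ given by $x:U\to X_K$ and a bundle $\mathcal E$ over $X_K\times_K U$ is $(x,\mathrm{id}_U)^*\mathcal E$. (1) (Arithmetic Frobenius.)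 Let $\mathrm{Frob}_X=\mathrm{id}_X\times\sigma:X_K\to X_K$, a morphism lying over $\sigma$. For a $K$-scheme $U$, let $U'$ be the scheme $U$ with its structure morphism to $\operatorname{Spec}K$ composed with $\sigma^{-1}$; then $\mathrm{Frob}_X\times\mathrm{id}_U:X_K\times_K U'\to X_K\times_K U$, and the induced arithmetic Frobenius $\psi:\mathrm{Bun}\to\mathrm{Bun}$, $(U,\mathcal E)\mapsto(U',(\mathrm{Frob}_X\times\mathrm{id}_U)^*\mathcal E)$, lies over $\sigma^{-1}$. For every $\theta$ there is exactly one component $\theta'$ such that $\psi$ maps $\mathrm{Bun}^\theta$ to $\mathrm{Bun}^{\theta'}$, and for this $\theta'$ there is a natural isomorphism of principal $G$-bundles (natural in the objects of the stack) $$(\mathrm{Frob}_X\times\mathrm{id}_{\mathrm{Bun}^\theta})^*(\mathcal P^{univ}_\theta)\cong(\mathrm{id}_{X_K}\times\psi)^*(\mathcal P^{univ}_{\theta'})$$ on the common source of $\mathrm{Frob}_X\times\mathrm{id}_{\mathrm{Bun}^\theta}$ and $\mathrm{id}_{X_K}\times\psi$, the fibre product of $X_K$ and $\mathrm{Bun}^\theta$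 over $\operatorname{Spec}K$ in which $X_K$ has its structure morphism composed with $\sigma$. (2) (Geometric Frobenius.) Let $F_X=(\mathrm{id}_X,f\mapsto f^q):X\to X$ be the absolute Frobenius, $\overline F_X=F_X\times\mathrm{id}_{\operatorname{Spec}K}:X_K\to X_K$, and $\varphi:\mathrm{Bun}\to\mathrm{Bun}$, $(U,\mathcal E)\mapsto(U,(\overline F_X\times\mathrm{id}_U)^*\mathcal E)$ the induced geometric Frobenius, a morphism of stacks over $K$. For every $\theta$ there is exactly one component $\theta'$ such that $\varphi$ maps $\mathrm{Bun}^\theta$ to $\mathrm{Bun}^{\theta'}$, and for this $\theta'$ there is a natural isomorphism of principal $G$-bundles (natural in the objects of the stack) on $X_K\times_K\mathrm{Bun}^\theta$ $$(\overline F_X\times\mathrm{id}_{\mathrm{Bun}^\theta})^*(\mathcal P^{univ}_\theta)\cong(\mathrm{id}_{X_K}\times\varphi)^*(\mathcal P^{univ}_{\theta'}).$$ In particular, if $\psi$ (respectively $\varphi$) maps $\mathrm{Bun}^\theta$ to itself, both pullbacks are pullbacks of the same universal bundle $\mathcal P^{univ}_\theta$. -/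

import Mathlib

open CategoryTheory MonoidalCategory CartesianMonoidalCategory Limits MonObj AlgebraicGeometry

universe u

noncomputable section

namespace FrobBun

/-- The category of schemes over the field `k`. -/
abbrev Sch (k : Type u) [Field k] : Type (u + 1) := Over (Spec (CommRingCat.of k))

/-! ### The absolute `q`-Frobenius of a scheme over a finite field with `q` elements -/

section AbsoluteFrobenius

variable (k : Type u) [Field k]

/-- The `k`-algebra structure map `k → Γ(X, U)` of the sections of a `k`-scheme `X` over `U`. -/
def structureMap {k : Type u} [Field k] (X : Sch k) (U : X.left.Opens) : k →+* Γ(X.left, U) :=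
  ((X.left.presheaf.map (homOfLE le_top).op).hom.comp
    ((X.hom.appTop).hom)).comp (Scheme.ΓSpecIso (CommRingCat.of k)).inv.hom

/-- The ring homomorphism `a ↦ a ^ q` of a ring `R` which is an algebra over the field `k` with
`q` elements through `i`. -/
def powRingHom [Fintype k] {R : Type u} [CommRing R] (i : k →+* R) : R →+* R :=
  letI := i.toAlgebra
  (FiniteField.frobeniusAlgHom k R).toRingHom

lemma powRingHom_apply [Fintype k] {R : Type u} [CommRing R] (i : k →+* R) (a : R) :
    powRingHom k i a = a ^ Fintype.card k := rfl

/-- The morphism `(id_X, f ↦ f ^ q)` of ringed spaces. -/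
def absFrobPresheafed [Fintype k] (X : Sch k) :
    PresheafedSpace.Hom X.left.toPresheafedSpace X.left.toPresheafedSpace where
  base := 𝟙 _
  c :=
    { app := fun U => CommRingCat.ofHom (powRingHom k (structureMap X U.unop))
      naturality := by
        intro U V f
        ext a
        exact (map_pow (X.left.presheaf.map f).hom a (Fintype.card k)).symm }

lemma absFrobPresheafed_stalkMap [Fintype k] (X : Sch k) (x : X.left)
    (a : X.left.presheaf.stalk x) :
    ((absFrobPresheafed k X).stalkMap x).hom a = a ^ Fintype.card k := by
  obtain ⟨U, hx, s, rfl⟩ := X.left.presheaf.exists_germ_eq a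
  have := ConcreteCategory.congr_hom
    (PresheafedSpace.stalkMap_germ (absFrobPresheafed k X) U x hx) s
  refine this.trans ?_
  exact map_pow (X.left.presheaf.germ U x hx).hom s (Fintype.card k)

/-- The morphism of schemes `(id_X, f ↦ f ^ q)`. -/
def absFrobScheme [Fintype k] (X : Sch k) : X.left ⟶ X.left :=
  Scheme.Hom.mk ⟨absFrobPresheafed k X, fun x => ⟨fun a ha =>
    (isUnit_pow_iff Fintype.card_ne_zero).1 ((absFrobPresheafed_stalkMap k X x a) ▸ ha)⟩⟩

/-- The absolute geometric Frobenius `F_X = (id_X, f ↦ f ^ q)`, a morphism of `k`-schemes. -/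
def absFrob [Fintype k] (X : Sch k) : X ⟶ X :=
  Over.homMk (absFrobScheme k X) (by
    apply ext_of_isAffine
    ext a
    obtain ⟨b, rfl⟩ : ∃ b, (Scheme.ΓSpecIso (CommRingCat.of k)).inv.hom b = a :=
      ⟨(Scheme.ΓSpecIso (CommRingCat.of k)).hom.hom a, by
        exact ConcreteCategory.congr_hom (Scheme.ΓSpecIso (CommRingCat.of k)).hom_inv_id a⟩
    have h1 : ∀ c : Γ(X.left, ⊤), (absFrobScheme k X).appTop.hom c = c ^ Fintype.card k :=
      fun c => rfl
    rw [Scheme.Hom.comp_appTop, CommRingCat.hom_comp, RingHom.comp_apply, h1, ← map_pow,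
      ← map_pow, FiniteField.pow_card])

end AbsoluteFrobenius

/-! ### Principal bundles and the classifying stack -/

section PrincipalBundles

/-- A principal `G`-bundle over `T`, for a group scheme `G` over `k` and a `k`-scheme `T`:
a scheme over `T` with a right action of `G` over `T` which is simply transitive on the fibres
(on points with values in any scheme) and which has sections locally for the étale topology,
i.e. is étale-locally trivial. For a field extension `K / k` and a scheme `T` over `K` this is
the same as a principal bundle over `T` under the base change of `G` to `K`. -/
structure Torsor {k : Type u} [Field k] (G : Sch k) [GrpObj G] (T : Sch k) where
  /-- the total space -/
  total : Sch k
  /-- the projection -/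
  proj : total ⟶ T
  /-- the right action -/
  act : total ⊗ G ⟶ total
  act_proj : act ≫ proj = fst total G ≫ proj
  act_one : ∀ {Y : Sch k} (x : Y ⟶ total), lift x (1 : Y ⟶ G) ≫ act = x
  act_mul : ∀ {Y : Sch k} (x : Y ⟶ total) (g h : Y ⟶ G),
    lift (lift x g ≫ act) h ≫ act = lift x (g * h) ≫ act
  simply_transitive : ∀ {Y : Sch k} (x y : Y ⟶ total), x ≫ proj = y ≫ proj →
    ∃! g : Y ⟶ G, lift x g ≫ act = y
  locally_trivial : ∃ (T' : Sch k) (t : T' ⟶ T) (s : T' ⟶ total),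
    Etale t.left ∧ Surjective t.left ∧ s ≫ proj = t

/-- The objects of the classifying stack of `G`: principal `G`-bundles over varying base schemes. -/
structure BG {k : Type u} [Field k] (G : Sch k) [GrpObj G] where
  /-- the base scheme -/
  base : Sch k
  /-- the principal bundle -/
  torsor : Torsor G base

variable {k : Type u} [Field k] {G : Sch k} [GrpObj G]

namespace BG

/-- A morphism of principal bundles over varying bases: a `G`-equivariant cartesian square.
The morphisms lying over an identity are exactly the isomorphisms of principal bundles. -/
@[ext]
structure Hom (P Q : BG G) where
  /-- the morphism of base schemes -/
  base : P.base ⟶ Q.base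
  /-- the morphism of total spaces -/
  total : P.torsor.total ⟶ Q.torsor.total
  equivariant : P.torsor.act ≫ total = (total ▷ G) ≫ Q.torsor.act
  isPullback : IsPullback total P.torsor.proj Q.torsor.proj base

instance : Category (BG G) where
  Hom := Hom
  id P := ⟨𝟙 _, 𝟙 _, by simp, IsPullback.of_horiz_isIso ⟨by simp⟩⟩
  comp f g := ⟨f.base ≫ g.base, f.total ≫ g.total,
    by rw [← Category.assoc, f.equivariant, Category.assoc, g.equivariant]; simp,
    f.isPullback.paste_horiz g.isPullback⟩

@[ext]
lemma hom_ext {P Q : BG G} {f g : P ⟶ Q} (h₁ : Hom.base f = Hom.base g)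
    (h₂ : Hom.total f = Hom.total g) : f = g := Hom.ext h₁ h₂

@[simp] lemma id_base (P : BG G) : Hom.base (𝟙 P) = 𝟙 _ := rfl
@[simp] lemma id_total (P : BG G) : Hom.total (𝟙 P) = 𝟙 _ := rfl
@[simp] lemma comp_base {P Q R : BG G} (f : P ⟶ Q) (g : Q ⟶ R) :
    Hom.base (f ≫ g) = Hom.base f ≫ Hom.base g := rfl
@[simp] lemma comp_total {P Q R : BG G} (f : P ⟶ Q) (g : Q ⟶ R) :
    Hom.total (f ≫ g) = Hom.total f ≫ Hom.total g := rfl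

end BG

variable (G) in
/-- The classifying stack of `G`, as a category fibred (in groupoids) over `k`-schemes. -/
def classifyingStack : BasedCategory (Sch k) where
  obj := BG G
  p := { obj := fun P => P.base, map := fun f => BG.Hom.base f }

namespace Torsor

attribute [local simp] pullback.lift_fst pullback.lift_snd pullback.lift_fst_assoc
  pullback.lift_snd_assoc

variable {T S : Sch k} (P : Torsor G T) (h : S ⟶ T)

/-- The action of `G` on the pullback of a principal bundle. -/
def pullbackAct : Limits.pullback P.proj h ⊗ G ⟶ Limits.pullback P.proj h :=
  pullback.lift ((pullback.fst P.proj h ▷ G) ≫ P.act) (fst _ _ ≫ pullback.snd P.proj h) (by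
    rw [Category.assoc, P.act_proj, whiskerRight_fst_assoc, pullback.condition, Category.assoc])

@[simp]
lemma lift_pullbackAct_fst {Y : Sch k} (x : Y ⟶ Limits.pullback P.proj h) (g : Y ⟶ G) :
    lift x g ≫ P.pullbackAct h ≫ pullback.fst P.proj h =
      lift (x ≫ pullback.fst P.proj h) g ≫ P.act := by
  simp [pullbackAct]

@[simp]
lemma lift_pullbackAct_snd {Y : Sch k} (x : Y ⟶ Limits.pullback P.proj h) (g : Y ⟶ G) :
    lift x g ≫ P.pullbackAct h ≫ pullback.snd P.proj h = x ≫ pullback.snd P.proj h := by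
  simp [pullbackAct]

/-- The pullback `h^* P` of a principal bundle `P` over `T` along `h : S ⟶ T`. -/
def pullback : Torsor G S where
  total := Limits.pullback P.proj h
  proj := pullback.snd P.proj h
  act := P.pullbackAct h
  act_proj := by simp [pullbackAct]
  act_one x := by apply pullback.hom_ext <;> simp [P.act_one]
  act_mul x g h' := by
    apply pullback.hom_ext
    · simpa using P.act_mul (x ≫ pullback.fst P.proj h) g h'
    · simp
  simply_transitive x y hxy := by
    obtain ⟨g, hg, hu⟩ := P.simply_transitive (x ≫ pullback.fst P.proj h)
      (y ≫ pullback.fst P.proj h) (by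
        rw [Category.assoc, Category.assoc, pullback.condition, reassoc_of% hxy])
    refine ⟨g, ?_, fun g' hg' => hu g' ?_⟩
    · apply pullback.hom_ext
      · simpa using hg
      · simpa using hxy
    · simp [← hg']
  locally_trivial := by
    obtain ⟨T', t, s, he, hs, hst⟩ := P.locally_trivial
    refine ⟨Limits.pullback t h, pullback.snd t h,
      pullback.lift (pullback.fst t h ≫ s) (pullback.snd t h) (by
        rw [Category.assoc, hst, pullback.condition]), ?_, ?_, by simp⟩
    · exact MorphismProperty.of_isPullback (P := @Etale)
        ((IsPullback.of_hasPullback t h).map (Over.forget _)) he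
    · exact MorphismProperty.of_isPullback (P := @Surjective)
        ((IsPullback.of_hasPullback t h).map (Over.forget _)) hs

/-- The canonical morphism `h^* P ⟶ P` of principal bundles over `h`. -/
def pullbackProj : BG.mk S (P.pullback h) ⟶ BG.mk T P where
  base := h
  total := pullback.fst P.proj h
  equivariant := pullback.lift_fst _ _ _
  isPullback := IsPullback.of_hasPullback P.proj h

@[simp] lemma pullbackProj_base : BG.Hom.base (P.pullbackProj h) = h := rfl

variable {P h} in
lemma pullback_hom_ext {Q : BG G} {f g : Q ⟶ BG.mk S (P.pullback h)}
    (h₁ : BG.Hom.base f = BG.Hom.base g)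
    (h₂ : f ≫ P.pullbackProj h = g ≫ P.pullbackProj h) : f = g := by
  apply BG.hom_ext h₁
  apply pullback.hom_ext
  · exact congrArg BG.Hom.total h₂
  · exact (f.isPullback.w.trans (by rw [h₁])).trans g.isPullback.w.symm

variable {P} {T' S' : Sch k} {P' : Torsor G T'}

/-- The morphism `h^* P ⟶ h'^* P'` over `b` induced by a morphism `f : P ⟶ P'` of principal
bundles, for a commutative square `h ≫ f.base = b ≫ h'`. -/
def pullbackMap (f : BG.mk T P ⟶ BG.mk T' P') (h : S ⟶ T) (h' : S' ⟶ T') (b : S ⟶ S')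
    (w : h ≫ BG.Hom.base f = b ≫ h') : BG.mk S (P.pullback h) ⟶ BG.mk S' (P'.pullback h') :=
  have hw : BG.Hom.total f ≫ P'.proj = P.proj ≫ BG.Hom.base f := f.isPullback.w
  have he : P.act ≫ BG.Hom.total f = (BG.Hom.total f ▷ G) ≫ P'.act := f.equivariant
  have hc : (pullback.fst P.proj h ≫ BG.Hom.total f) ≫ P'.proj =
      (pullback.snd P.proj h ≫ b) ≫ h' := by
    rw [Category.assoc, hw, pullback.condition_assoc, w, Category.assoc]
  { base := b
    total := pullback.lift (pullback.fst P.proj h ≫ BG.Hom.total f) (pullback.snd P.proj h ≫ b) hc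
    equivariant := by
      change P.pullbackAct h ≫ pullback.lift _ _ hc = (pullback.lift _ _ hc ▷ G) ≫ P'.pullbackAct h'
      apply pullback.hom_ext
      · have e : (pullback.lift _ _ hc ▷ G) ≫ (pullback.fst P'.proj h' ▷ G) =
            (pullback.fst P.proj h ▷ G) ≫ (BG.Hom.total f ▷ G) := by
          rw [← comp_whiskerRight, ← comp_whiskerRight, pullback.lift_fst]
        simp [pullbackAct, he, reassoc_of% e]
      · simp [pullbackAct]
    isPullback := by
      refine IsPullback.of_right (h₁₂ := pullback.fst P'.proj h') (v₁₃ := P'.proj) (h₂₂ := h') ?_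
        (pullback.lift_snd _ _ hc) (IsPullback.of_hasPullback P'.proj h')
      have h1 : IsPullback (pullback.fst P.proj h ≫ BG.Hom.total f) (pullback.snd P.proj h) P'.proj
        (h ≫ BG.Hom.base f) := (IsPullback.of_hasPullback P.proj h).paste_horiz f.isPullback
      rw [w, ← pullback.lift_fst _ _ hc] at h1
      exact h1 }

@[simp]
lemma pullbackMap_base (f : BG.mk T P ⟶ BG.mk T' P') (h : S ⟶ T) (h' : S' ⟶ T') (b : S ⟶ S')
    (w : h ≫ BG.Hom.base f = b ≫ h') : BG.Hom.base (pullbackMap f h h' b w) = b := rfl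

@[simp]
lemma pullbackMap_proj (f : BG.mk T P ⟶ BG.mk T' P') (h : S ⟶ T) (h' : S' ⟶ T') (b : S ⟶ S')
    (w : h ≫ BG.Hom.base f = b ≫ h') :
    pullbackMap f h h' b w ≫ P'.pullbackProj h' = P.pullbackProj h ≫ f :=
  BG.hom_ext w.symm (pullback.lift_fst _ _ _)

@[simp]
lemma pullbackMap_proj_assoc (f : BG.mk T P ⟶ BG.mk T' P') (h : S ⟶ T) (h' : S' ⟶ T')
    (b : S ⟶ S') (w : h ≫ BG.Hom.base f = b ≫ h') {Q : BG G} (g : BG.mk T' P' ⟶ Q) :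
    pullbackMap f h h' b w ≫ P'.pullbackProj h' ≫ g = P.pullbackProj h ≫ f ≫ g := by
  rw [← Category.assoc, pullbackMap_proj, Category.assoc]

end Torsor

end PrincipalBundles

/-! ### The base change of a curve and the products `X_K ×_K U` -/

section BaseChange

variable (k : Type u) [Field k] (K : Type u) [Field K] [Algebra k K]

/-- `Spec K` as a scheme over `k`. Schemes over `K` are the objects of `Over (specK k K)`. -/
def specK : Sch k := Over.mk (Spec.map (CommRingCat.ofHom (algebraMap k K)))

/-- The automorphism `Frob_{Spec K}` of `Spec K` over `k` induced by `a ↦ a ^ q` on `K`, where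
`k` has `q` elements and `K` is algebraic over `k`. -/
def frobSpec [Fintype k] [Algebra.IsAlgebraic k K] : specK k K ≅ specK k K :=
  Over.isoMk (Scheme.Spec.mapIso
    (FiniteField.frobeniusAlgEquivOfAlgebraic k K).toRingEquiv.toCommRingCatIso.op) (by
      change Spec.map _ ≫ Spec.map _ = Spec.map _
      rw [← Spec.map_comp]
      congr 1
      ext x
      exact (FiniteField.frobeniusAlgEquivOfAlgebraic k K).commutes x)

lemma frobSpec_hom_left [Fintype k] [Algebra.IsAlgebraic k K] :
    (frobSpec k K).hom.left =
      Spec.map (CommRingCat.ofHom (FiniteField.frobeniusAlgHom k K : K →+* K)) := rfl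

variable {k} (X : Sch k)

/-- The base change `X_K = X ×_k Spec K`, as a scheme over `K`. -/
abbrev baseChange : Over (specK k K) := Over.mk (snd X (specK k K))

/-- The functor `U ↦ X_K ×_K U` from `K`-schemes to schemes. -/
def timesCurve : Over (specK k K) ⥤ Sch k where
  obj U := Limits.pullback (baseChange K X).hom U.hom
  map {U V} g := pullback.lift (pullback.fst _ _) (pullback.snd _ _ ≫ g.left)
    (by rw [Category.assoc, Over.w, pullback.condition])
  map_id U := by apply pullback.hom_ext <;> simp
  map_comp f g := by
    apply pullback.hom_ext <;> simp [pullback.lift_fst, pullback.lift_snd, pullback.lift_snd_assoc]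

namespace timesCurve

variable {K X}

/-- The projection `X_K ×_K U ⟶ X_K`. -/
def fst (U : Over (specK k K)) : (timesCurve K X).obj U ⟶ (baseChange K X).left :=
  pullback.fst _ _

/-- The projection `X_K ×_K U ⟶ U`. -/
def snd (U : Over (specK k K)) : (timesCurve K X).obj U ⟶ U.left :=
  pullback.snd _ _

lemma condition (U : Over (specK k K)) :
    fst U ≫ (baseChange K X).hom = snd U ≫ U.hom :=
  pullback.condition

/-- The morphism `(x, u) : S ⟶ X_K ×_K U`. -/
def lift {S : Sch k} {U : Over (specK k K)} (x : S ⟶ (baseChange K X).left) (u : S ⟶ U.left)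
    (w : x ≫ (baseChange K X).hom = u ≫ U.hom) : S ⟶ (timesCurve K X).obj U :=
  pullback.lift x u w

variable {S : Sch k} {U V : Over (specK k K)}

@[simp]
lemma lift_fst (x : S ⟶ (baseChange K X).left) (u : S ⟶ U.left) (w) :
    lift x u w ≫ fst U = x := pullback.lift_fst _ _ _

@[simp]
lemma lift_snd (x : S ⟶ (baseChange K X).left) (u : S ⟶ U.left) (w) :
    lift x u w ≫ snd U = u := pullback.lift_snd _ _ _

@[simp]
lemma lift_fst_assoc (x : S ⟶ (baseChange K X).left) (u : S ⟶ U.left) (w) {Z : Sch k}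
    (z : (baseChange K X).left ⟶ Z) : lift x u w ≫ fst U ≫ z = x ≫ z := by
  rw [← Category.assoc, lift_fst]

@[simp]
lemma lift_snd_assoc (x : S ⟶ (baseChange K X).left) (u : S ⟶ U.left) (w) {Z : Sch k}
    (z : U.left ⟶ Z) : lift x u w ≫ snd U ≫ z = u ≫ z := by
  rw [← Category.assoc, lift_snd]

@[simp]
lemma map_fst (g : U ⟶ V) : (timesCurve K X).map g ≫ fst V = fst U := pullback.lift_fst _ _ _

@[simp]
lemma map_snd (g : U ⟶ V) : (timesCurve K X).map g ≫ snd V = snd U ≫ g.left :=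
  pullback.lift_snd _ _ _

@[simp]
lemma map_fst_assoc (g : U ⟶ V) {Z : Sch k} (z : (baseChange K X).left ⟶ Z) :
    (timesCurve K X).map g ≫ fst V ≫ z = fst U ≫ z := by
  rw [← Category.assoc, map_fst]

lemma hom_ext {f g : S ⟶ (timesCurve K X).obj U} (h₁ : f ≫ fst U = g ≫ fst U)
    (h₂ : f ≫ snd U = g ≫ snd U) : f = g := pullback.hom_ext h₁ h₂

end timesCurve

end BaseChange

/-! ### The moduli stack of principal bundles -/

section Moduli

variable {k : Type u} [Field k] (K : Type u) [Field K] [Algebra k K] (X G : Sch k) [GrpObj G]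

/-- The objects of the moduli stack of principal `G`-bundles on `X_K`: a `K`-scheme `U` together
with a principal `G`-bundle over `X_K ×_K U`. -/
structure Bun where
  /-- the parameter scheme -/
  U : Over (specK k K)
  /-- the principal bundle over `X_K ×_K U` -/
  bundle : Torsor G ((timesCurve K X).obj U)

namespace Bun

variable {K X G}

/-- The principal bundle underlying an object of the moduli stack. -/
abbrev toBG (E : Bun K X G) : BG G := ⟨(timesCurve K X).obj E.U, E.bundle⟩

/-- A morphism from `(U, E)` to `(U', E')` consists of a morphism `U ⟶ U'` of `K`-schemes and a
(cartesian) morphism of principal bundles `E ⟶ E'` over the induced `X_K ×_K U ⟶ X_K ×_K U'`;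
the morphisms over the identity of `U` are the isomorphisms of principal bundles. -/
@[ext]
structure Hom (E E' : Bun K X G) where
  /-- the morphism of parameter schemes -/
  base : E.U ⟶ E'.U
  /-- the morphism of principal bundles -/
  map : E.toBG ⟶ E'.toBG
  map_base : BG.Hom.base map = (timesCurve K X).map base

instance : Category (Bun K X G) where
  Hom := Hom
  id E := ⟨𝟙 _, 𝟙 _, by simp⟩
  comp f g := ⟨f.base ≫ g.base, f.map ≫ g.map, by simp [f.map_base, g.map_base]⟩
  id_comp f := Hom.ext (by simp) (by simp)
  comp_id f := Hom.ext (by simp) (by simp)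
  assoc f g h := Hom.ext (by simp) (by simp)

@[ext]
lemma hom_ext {E E' : Bun K X G} {f g : E ⟶ E'} (h₁ : Hom.base f = Hom.base g)
    (h₂ : Hom.map f = Hom.map g) : f = g := Hom.ext h₁ h₂

@[simp] lemma id_base (E : Bun K X G) : Hom.base (𝟙 E) = 𝟙 _ := rfl
@[simp] lemma id_map (E : Bun K X G) : Hom.map (𝟙 E) = 𝟙 _ := rfl
@[simp] lemma comp_base {P Q R : Bun K X G} (f : P ⟶ Q) (g : Q ⟶ R) :
    Hom.base (f ≫ g) = Hom.base f ≫ Hom.base g := rfl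
@[simp] lemma comp_map {P Q R : Bun K X G} (f : P ⟶ Q) (g : Q ⟶ R) :
    Hom.map (f ≫ g) = Hom.map f ≫ Hom.map g := rfl

variable (K X G) in
/-- The structure functor of the moduli stack, as a category fibred over `K`-schemes. -/
@[simps]
def toK : Bun K X G ⥤ Over (specK k K) where
  obj E := E.U
  map f := Hom.base f

/-- Given a functor `Φ` on `K`-schemes and morphisms `f_U : X_K ×_K Φ(U) ⟶ X_K ×_K U` natural in
`U`, this is the endofunctor `(U, E) ↦ (Φ(U), f_U^* E)` of the moduli stack. -/
def pullbackAlong (Φ : Over (specK k K) ⥤ Over (specK k K))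
    (f : Φ ⋙ timesCurve K X ⟶ timesCurve K X) : Bun K X G ⥤ Bun K X G where
  obj E := ⟨Φ.obj E.U, E.bundle.pullback (f.app E.U)⟩
  map {E E'} g := ⟨Φ.map (Hom.base g), Torsor.pullbackMap (Hom.map g) (f.app E.U) (f.app E'.U)
    ((timesCurve K X).map (Φ.map (Hom.base g)))
    (by rw [Hom.map_base]; exact (f.naturality (Hom.base g)).symm), rfl⟩
  map_id E := by
    apply hom_ext
    · simp
    · apply Torsor.pullback_hom_ext
      · simp
      · simp
  map_comp g g' := by
    apply hom_ext
    · simp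
    · apply Torsor.pullback_hom_ext
      · simp
      · simp

end Bun

/-! ### Connected components of the moduli stack -/

/-- The set of points `|𝒴|` of a category `𝒴` fibred over `k`-schemes: pairs `(y, s)` of an object
`y` over a scheme and a point `s` of this scheme, modulo the equivalence relation generated by
`(y, s) ∼ (y', b(s))` for all morphisms `y ⟶ y'` over `b`. Restricting `y` to the residue field of
`s`, this is the set of objects over spectra of fields modulo common field extensions.
The quotient topology is the usual (Zariski) topology: a set of points is open if and only if its
preimage in the base scheme of every object is open. -/
def Points {𝒴 : Type*} [Category 𝒴] (p : 𝒴 ⥤ Sch k) : Type _ :=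
  Quot (fun a b : (Σ y : 𝒴, (p.obj y).left) => ∃ g : a.1 ⟶ b.1, (p.map g).left a.2 = b.2)

instance {𝒴 : Type*} [Category 𝒴] (p : 𝒴 ⥤ Sch k) : TopologicalSpace (Points p) :=
  inferInstanceAs (TopologicalSpace (Quot _))

/-- The set of connected components of the moduli stack. -/
def Component : Type _ := ConnectedComponents (Points (Bun.toK K X G ⋙ Over.forget _))

variable {K X G}

/-- `(U, E)` lies in the component `θ` if all the points of `U` are mapped to `θ`. -/
def inComponent (θ : Component K X G) : ObjectProperty (Bun K X G) := fun E =>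
  ∀ s : E.U.left.left, (ConnectedComponents.mk (Quot.mk _ ⟨E, s⟩) : Component K X G) = θ

/-- The connected component `Bun^θ` of the moduli stack: the full substack on the objects all of
whose points lie in `θ`. -/
abbrev BunComp (θ : Component K X G) : Type _ := (inComponent θ).FullSubcategory

/-- The structure functor of `Bun^θ` as a category fibred over `K`-schemes. -/
def BunComp.toK (θ : Component K X G) : BunComp θ ⥤ Over (specK k K) :=
  (inComponent θ).ι ⋙ Bun.toK K X G

/-- The endofunctor `F` of the moduli stack maps the component `θ` into the component `θ'`. -/
def MapsComponent (F : Bun K X G ⥤ Bun K X G) (θ θ' : Component K X G) : Prop :=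
  ∀ E, inComponent θ E → inComponent θ' (F.obj E)

/-- The functor `Bun^θ ⥤ Bun^θ'` given by an endofunctor of the moduli stack which maps the
component `θ` into the component `θ'`. -/
def MapsComponent.restrict {F : Bun K X G ⥤ Bun K X G} {θ θ' : Component K X G}
    (h : MapsComponent F θ θ') : BunComp θ ⥤ BunComp θ' :=
  (inComponent θ').lift ((inComponent θ).ι ⋙ F) (fun E => h E.obj E.property)

/-! ### Products with stacks over `K`, bundles on stacks, the universal bundle -/

/-- The product `T ×_K 𝒴` of a `K`-scheme `T` and a category `𝒴` fibred over `K`-schemes through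
`q`, as a category fibred over `k`-schemes: its objects are the pairs of an object `y` of `𝒴` and
a `K`-morphism `q(y) ⟶ T`. -/
def timesStack (T : Over (specK k K)) {𝒴 : Type*} [Category 𝒴] (q : 𝒴 ⥤ Over (specK k K)) :
    BasedCategory (Sch k) :=
  .ofFunctor (CostructuredArrow.proj q T ⋙ q ⋙ Over.forget _)

/-- The morphism `f × id : T ×_K 𝒴 ⟶ T' ×_K 𝒴`. -/
def timesStackMap {T T' : Over (specK k K)} (f : T ⟶ T') {𝒴 : Type*} [Category 𝒴]
    (q : 𝒴 ⥤ Over (specK k K)) : BasedFunctor (timesStack T q) (timesStack T' q) where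
  toFunctor := CostructuredArrow.map f
  w := rfl

variable (G) in
/-- A principal `G`-bundle on a stack `𝒴`, i.e. a morphism from `𝒴` to the classifying stack:
it assigns to every object `y` of `𝒴` over `S` a principal `G`-bundle over `S`, and to every
morphism of `𝒴` over `b` a cartesian morphism of bundles over `b`, functorially.
An isomorphism of principal bundles on `𝒴` is an isomorphism in the category of such morphisms. -/
abbrev GBundle (𝒴 : BasedCategory (Sch k)) : Type _ := BasedFunctor 𝒴 (classifyingStack G)

/-- The pullback of a principal bundle on a stack along a morphism of stacks. -/
abbrev GBundle.pullback {𝒴 𝒵 : BasedCategory (Sch k)} (f : BasedFunctor 𝒵 𝒴) (P : GBundle G 𝒴) :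
    GBundle G 𝒵 :=
  BasedFunctor.comp f P

/-- The section `(x, id) : U ⟶ X_K ×_K U` defined by a `K`-morphism `x : U ⟶ X_K`. -/
def graph {U : Over (specK k K)} (x : U ⟶ baseChange K X) : U.left ⟶ (timesCurve K X).obj U :=
  timesCurve.lift x.left (𝟙 U.left) (by rw [Over.w, Category.id_comp])

variable (K X G) in
/-- The functor underlying the universal bundle: it maps an object of `X_K ×_K Bun`, given by a
bundle `E` over `X_K ×_K U` and a `K`-morphism `x : U ⟶ X_K`, to `(x, id_U)^* E`. -/
def univFunctor : CostructuredArrow (Bun.toK K X G) (baseChange K X) ⥤ BG G where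
  obj A := ⟨A.left.U.left, A.left.bundle.pullback (graph A.hom)⟩
  map {A B} g := Torsor.pullbackMap (Bun.Hom.map g.left) (graph A.hom) (graph B.hom)
    (Bun.Hom.base g.left).left (by
      have e : (Bun.Hom.base g.left).left ≫ B.hom.left = A.hom.left :=
        congrArg CommaMorphism.left (CostructuredArrow.w g)
      rw [Bun.Hom.map_base]
      apply timesCurve.hom_ext
      · simp [graph, e]
      · simp [graph])
  map_id A := by
    apply Torsor.pullback_hom_ext
    · rfl
    · rw [Torsor.pullbackMap_proj, Category.id_comp]
      exact Category.comp_id _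
  map_comp g g' := by
    apply Torsor.pullback_hom_ext
    · rfl
    · rw [Torsor.pullbackMap_proj, Category.assoc, Torsor.pullbackMap_proj,
        Torsor.pullbackMap_proj_assoc]
      rfl

variable (K X G) in
/-- The universal principal `G`-bundle on `X_K ×_K Bun`. -/
def univBundle : GBundle G (timesStack (baseChange K X) (Bun.toK K X G)) where
  toFunctor := univFunctor K X G
  w := rfl

/-- The universal principal `G`-bundle on `X_K ×_K Bun^θ`, the restriction of the one on
`X_K ×_K Bun`. -/
def univBundleComp (θ : Component K X G) :
    GBundle G (timesStack (baseChange K X) (BunComp.toK θ)) where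
  toFunctor := CostructuredArrow.pre (inComponent θ).ι (Bun.toK K X G) (baseChange K X) ⋙
    (univBundle K X G).toFunctor
  w := rfl

end Moduli

/-! ### The arithmetic Frobenius and the induced arithmetic Frobenius -/

section Arithmetic

variable {k : Type u} [Field k] [Fintype k] (K : Type u) [Field K] [Algebra k K]
  [Algebra.IsAlgebraic k K] (X G : Sch k) [GrpObj G]

/-- The arithmetic Frobenius `Frob_X = id_X × Frob_{Spec K}` of `X_K`. -/
def arithFrob : (baseChange K X).left ⟶ (baseChange K X).left :=
  X ◁ (frobSpec k K).hom

/-- `Frob_X` is semilinear: it lies over `Frob_{Spec K}`. -/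
lemma arithFrob_comp :
    arithFrob K X ≫ (baseChange K X).hom = (baseChange K X).hom ≫ (frobSpec k K).hom :=
  whiskerLeft_snd _ _

/-- The morphisms `Frob_X × id_U`. As `Frob_X` lies over `Frob_{Spec K}`, the source is
`X_K ×_K U'`, where `U'` is the scheme `U` with the structure morphism to `Spec K` composed with
the inverse of `Frob_{Spec K}`. -/
def arithFrobTimes : Over.map (frobSpec k K).inv ⋙ timesCurve K X ⟶ timesCurve K X where
  app U := timesCurve.lift
    (timesCurve.fst ((Over.map (frobSpec k K).inv).obj U) ≫ arithFrob K X)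
    (timesCurve.snd ((Over.map (frobSpec k K).inv).obj U)) (by
      rw [Category.assoc, arithFrob_comp, ← Category.assoc, timesCurve.condition,
        Over.map_obj_hom, Category.assoc, Category.assoc, Iso.inv_hom_id, Category.comp_id])
  naturality U V g := by
    apply timesCurve.hom_ext <;> simp

/-- The induced arithmetic Frobenius `ψ : E ↦ (Frob_X × id_U)^* E` of the moduli stack. -/
def psi : Bun K X G ⥤ Bun K X G :=
  Bun.pullbackAlong (Over.map (frobSpec k K).inv) (arithFrobTimes K X)

/-- `ψ` lies over the inverse of `Frob_{Spec K}`. -/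
lemma psi_comp_toK :
    psi K X G ⋙ Bun.toK K X G = Bun.toK K X G ⋙ Over.map (frobSpec k K).inv := rfl

/-- The scheme `X_K` with its structure morphism to `Spec K` composed with `Frob_{Spec K}`. -/
abbrev twistedCurve : Over (specK k K) := (Over.map (frobSpec k K).hom).obj (baseChange K X)

/-- `Frob_X` as a `K`-morphism from the twisted curve to `X_K`. -/
def arithFrobK : twistedCurve K X ⟶ baseChange K X :=
  Over.homMk (arithFrob K X) (arithFrob_comp K X)

variable {K X G}

/-- The common source of `Frob_X × id` and `id × ψ`: the fibre product over `Spec K` of `X_K` and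
`Bun^θ`, where `X_K` is considered over `Spec K` through its structure morphism composed with
`Frob_{Spec K}`. -/
abbrev arithSource (θ : Component K X G) : BasedCategory (Sch k) :=
  timesStack (twistedCurve K X) (BunComp.toK θ)

/-- The morphism `Frob_X × id_{Bun^θ}`. -/
def arithFrobTimesId (θ : Component K X G) :
    BasedFunctor (arithSource θ) (timesStack (baseChange K X) (BunComp.toK θ)) :=
  timesStackMap (arithFrobK K X) (BunComp.toK θ)

/-- The morphism `id_{X_K} × ψ`, where `ψ` maps `Bun^θ` to `Bun^θ'`. -/
def idTimesPsi {θ θ' : Component K X G} (h : MapsComponent (psi K X G) θ θ') :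
    BasedFunctor (arithSource θ) (timesStack (baseChange K X) (BunComp.toK θ')) where
  obj A := CostructuredArrow.mk (Y := h.restrict.obj A.left)
    (Over.homMk A.hom.left (by
      have e : A.hom.left ≫ (baseChange K X).hom ≫ (frobSpec k K).hom =
        ((BunComp.toK θ).obj A.left).hom := Over.w A.hom
      change A.hom.left ≫ (baseChange K X).hom =
        ((BunComp.toK θ).obj A.left).hom ≫ (frobSpec k K).inv
      rw [← e, Category.assoc, Category.assoc, Iso.hom_inv_id, Category.comp_id]) :
      (BunComp.toK θ').obj (h.restrict.obj A.left) ⟶ baseChange K X)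
  map {A B} g := CostructuredArrow.homMk (h.restrict.map g.left) (by
    apply Over.OverMorphism.ext
    have e := congrArg (fun m => CommaMorphism.left m) (CostructuredArrow.w g)
    exact e)
  map_id A := by
    apply CostructuredArrow.hom_ext
    exact h.restrict.map_id A.left
  map_comp g g' := by
    apply CostructuredArrow.hom_ext
    exact h.restrict.map_comp g.left g'.left
  w := rfl

end Arithmetic

/-! ### The geometric Frobenius and the induced geometric Frobenius -/

section Geometric

variable {k : Type u} [Field k] [Fintype k] (K : Type u) [Field K] [Algebra k K]
  (X G : Sch k) [GrpObj G]

/-- The geometric Frobenius `F_X × id_{Spec K}` of `X_K`. -/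
def geomFrob : (baseChange K X).left ⟶ (baseChange K X).left :=
  absFrob k X ▷ specK k K

lemma geomFrob_comp : geomFrob K X ≫ (baseChange K X).hom = (baseChange K X).hom :=
  whiskerRight_snd _ _

/-- The geometric Frobenius as a morphism of `K`-schemes. -/
def geomFrobK : baseChange K X ⟶ baseChange K X :=
  Over.homMk (geomFrob K X) (geomFrob_comp K X)

/-- The morphisms from `X_K ×_K U` to itself given by the geometric Frobenius of `X_K` and the
identity of `U`. -/
def geomFrobTimes : 𝟭 _ ⋙ timesCurve K X ⟶ timesCurve K X where
  app U := timesCurve.lift (timesCurve.fst U ≫ geomFrob K X) (timesCurve.snd U) (by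
    rw [Category.assoc, geomFrob_comp, timesCurve.condition])
  naturality U V g := by
    apply timesCurve.hom_ext <;> simp

/-- The induced geometric Frobenius `φ : E ↦ (F × id_U)^* E` of the moduli stack, where `F` is the
geometric Frobenius of `X_K`. -/
def phi : Bun K X G ⥤ Bun K X G :=
  Bun.pullbackAlong (𝟭 _) (geomFrobTimes K X)

/-- `φ` is a morphism of stacks over `K`. -/
lemma phi_comp_toK : phi K X G ⋙ Bun.toK K X G = Bun.toK K X G := rfl

variable {K X G}

/-- The product of the geometric Frobenius of `X_K` and the identity of `Bun^θ`. -/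
def geomFrobTimesId (θ : Component K X G) :
    BasedFunctor (timesStack (baseChange K X) (BunComp.toK θ))
      (timesStack (baseChange K X) (BunComp.toK θ)) :=
  timesStackMap (geomFrobK K X) (BunComp.toK θ)

/-- The morphism `id_{X_K} × φ`, where `φ` maps `Bun^θ` to `Bun^θ'`. -/
def idTimesPhi {θ θ' : Component K X G} (h : MapsComponent (phi K X G) θ θ') :
    BasedFunctor (timesStack (baseChange K X) (BunComp.toK θ))
      (timesStack (baseChange K X) (BunComp.toK θ')) where
  obj A := CostructuredArrow.mk (Y := h.restrict.obj A.left)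
    (A.hom : (BunComp.toK θ').obj (h.restrict.obj A.left) ⟶ baseChange K X)
  map {A B} g := CostructuredArrow.homMk (h.restrict.map g.left) (CostructuredArrow.w g)
  map_id A := by
    apply CostructuredArrow.hom_ext
    exact h.restrict.map_id A.left
  map_comp g g' := by
    apply CostructuredArrow.hom_ext
    exact h.restrict.map_comp g.left g'.left
  w := rfl

end Geometric

end FrobBun

end

/-! Naturality is functoriality of pullback. Evaluate both sides at an object of the source: a
bundle `E` over `X_K ×_K U` together with a point `x` of the curve over `U`. Write `F` for the
Frobenius of `X_K` in question. Pulling the universal bundle back along `F × id` replaces `x` by `F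
∘ x` and gives `(F ∘ x, id)^* E`. Pulling it back along `id × ψ` or `id × φ` keeps `x` but replaces
`E` by `(F × id)^* E`, which gives `(x, id)^* (F × id)^* E`. Since `(F × id) ∘ (x, id) = (F ∘ x,
id)` (`graph_comp_arithFrobTimes`, `graph_comp_geomFrobTimes`), the canonical isomorphism `g^* f^* E
≅ (g ≫ f)^* E` (`Torsor.pullbackCompIso`) identifies the two values. It is natural in `E` because
morphisms into a pulled back bundle are determined by their base and their composite with the
projection.

For the components, `ψ` and `φ` leave the parameter scheme unchanged as a `k`-scheme; `ψ` only
alters its structure morphism to `Spec K`. Each therefore induces a continuous map on the points of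
the moduli stack, hence a map on connected components, which gives existence of `θ'`. It is unique
because every `θ` contains an object with nonempty parameter scheme. -/

noncomputable section

namespace FrobBun

/-! ### Iterated pullback of principal bundles -/

section Bundles

variable {k : Type u} [Field k] {G : Sch k} [GrpObj G]

/-- A morphism of principal bundles over an isomorphism is an isomorphism. -/
def BG.isoOfBase {P Q : BG G} (f : P ⟶ Q) [IsIso (BG.Hom.base f)] : P ≅ Q :=
  have : IsIso (BG.Hom.total f) :=
    -- The square is cartesian, so the map of total spaces is a base change of the map of bases.
    (MorphismProperty.isomorphisms (Sch k)).of_isPullback f.isPullback.flip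
      ‹IsIso (BG.Hom.base f)›
  { hom := f
    inv :=
      { base := inv (BG.Hom.base f)
        total := inv (BG.Hom.total f)
        equivariant := by
          have e : P.torsor.act ≫ BG.Hom.total f = (BG.Hom.total f ▷ G) ≫ Q.torsor.act :=
            f.equivariant
          rw [IsIso.comp_inv_eq, Category.assoc, e, ← comp_whiskerRight_assoc, IsIso.inv_hom_id,
            id_whiskerRight, Category.id_comp]
        isPullback := IsPullback.of_horiz_isIso ⟨by
          have w : BG.Hom.total f ≫ Q.torsor.proj = P.torsor.proj ≫ BG.Hom.base f :=
            f.isPullback.w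
          rw [IsIso.inv_comp_eq, ← Category.assoc, w, Category.assoc, IsIso.hom_inv_id,
            Category.comp_id]⟩ }
    hom_inv_id := BG.hom_ext (IsIso.hom_inv_id _) (IsIso.hom_inv_id _)
    inv_hom_id := BG.hom_ext (IsIso.inv_hom_id _) (IsIso.inv_hom_id _) }

/-- The canonical isomorphism `g^* f^* P ≅ h^* P` for `h = g ≫ f`. -/
def Torsor.pullbackCompIso {T S R : Sch k} (P : Torsor G T) (f : S ⟶ T) (g : R ⟶ S) (h : R ⟶ T)
    (w : g ≫ f = h) :
    BG.mk R ((P.pullback f).pullback g) ≅ BG.mk R (P.pullback h) :=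
  have : IsIso (BG.Hom.base (Torsor.pullbackMap (P.pullbackProj f) g h (𝟙 R)
    (w.trans (Category.id_comp h).symm))) := inferInstanceAs (IsIso (𝟙 R))
  BG.isoOfBase (Torsor.pullbackMap (P.pullbackProj f) g h (𝟙 R)
    (w.trans (Category.id_comp h).symm))

-- Together with having base `𝟙 R`, this characterises the isomorphism, by
-- `Torsor.pullback_hom_ext`. The naturality below uses only these two facts about it.
@[simp]
lemma Torsor.pullbackCompIso_hom_proj {T S R : Sch k} (P : Torsor G T) (f : S ⟶ T) (g : R ⟶ S)
    (h : R ⟶ T) (w : g ≫ f = h) :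
    (P.pullbackCompIso f g h w).hom ≫ P.pullbackProj h =
      (P.pullback f).pullbackProj g ≫ P.pullbackProj f :=
  Torsor.pullbackMap_proj (P.pullbackProj f) g h (𝟙 R) (w.trans (Category.id_comp h).symm)

/-- Isomorphisms of bundles on a stack must be vertical: each component has to lie over the identity
of the base. -/
lemma Torsor.isHomLift_pullbackCompIso {T S R : Sch k} (P : Torsor G T) (f : S ⟶ T) (g : R ⟶ S)
    (h : R ⟶ T) (w : g ≫ f = h) :
    (classifyingStack G).p.IsHomLift (𝟙 R) (P.pullbackCompIso f g h w).hom :=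
  IsHomLift.of_fac (classifyingStack G).p (𝟙 R) (P.pullbackCompIso f g h w).hom rfl rfl
    ((Category.id_comp _).trans (Category.comp_id _)).symm

/-- The isomorphisms `g^* f^* P ≅ (g ≫ f)^* P` are natural. -/
lemma Torsor.pullbackCompIso_naturality {T S R T' S' R' : Sch k} {P : Torsor G T}
    {P' : Torsor G T'} (m : BG.mk T P ⟶ BG.mk T' P') {f : S ⟶ T} {g : R ⟶ S} {h : R ⟶ T}
    {f' : S' ⟶ T'} {g' : R' ⟶ S'} {h' : R' ⟶ T'} (w : g ≫ f = h) (w' : g' ≫ f' = h')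
    (b : S ⟶ S') (c : R ⟶ R') (hb : f ≫ BG.Hom.base m = b ≫ f') (hc : g ≫ b = c ≫ g')
    (hm : h ≫ BG.Hom.base m = c ≫ h') :
    Torsor.pullbackMap (Torsor.pullbackMap m f f' b hb) g g' c hc ≫
        (P'.pullbackCompIso f' g' h' w').hom =
      (P.pullbackCompIso f g h w).hom ≫ Torsor.pullbackMap m h h' c hm := by
  apply Torsor.pullback_hom_ext
  · exact (Category.comp_id c).trans (Category.id_comp c).symm
  -- After projection to `P'`, both sides become the composite of the two projections `g^* f^* P ⟶
  -- f^* P ⟶ P` with `m`.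
  · have e₁ := Torsor.pullbackMap_proj_assoc (Torsor.pullbackMap m f f' b hb) g g' c hc
      (P'.pullbackProj f')
    have e₂ := Torsor.pullbackMap_proj m h h' c hm
    have e₃ := Torsor.pullbackMap_proj m f f' b hb
    have e₄ := Torsor.pullbackCompIso_hom_proj P f g h w
    have e₅ := Torsor.pullbackCompIso_hom_proj P' f' g' h' w'
    rw [Category.assoc, Category.assoc, e₂, e₅, reassoc_of% e₄, ← e₃]
    exact e₁

/-- Construct an isomorphism of principal bundles on a stack from isomorphisms of their values. -/
def GBundle.isoMk {𝒴 : BasedCategory (Sch k)} (P Q : GBundle G 𝒴)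
    (e : ∀ A : 𝒴.obj, @Iso (BG G) _ (P.obj A) (Q.obj A))
    (base : ∀ A : 𝒴.obj, (classifyingStack G).p.IsHomLift (𝟙 (𝒴.p.obj A)) (e A).hom)
    (naturality : ∀ {A B : 𝒴.obj} (m : A ⟶ B),
      CategoryStruct.comp (obj := BG G) (P.map m) (e B).hom =
        CategoryStruct.comp (obj := BG G) (e A).hom (Q.map m)) : P ≅ Q :=
  BasedNatIso.mkNatIso (NatIso.ofComponents e naturality) base

end Bundles

/-! ### Action on points and connected components -/

section Components

variable {k : Type u} [Field k] {K : Type u} [Field K] [Algebra k K] {X G : Sch k} [GrpObj G]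

lemma Points.continuous_mk {𝒴 : Type*} [Category 𝒴] (p : 𝒴 ⥤ Sch k) (y : 𝒴) :
    Continuous fun s : (p.obj y).left => (Quot.mk _ ⟨y, s⟩ : Points p) :=
  continuous_quot_mk.comp continuous_sigmaMk

/-- A functor over the category of `k`-schemes induces a map on points. -/
def Points.map {𝒴 𝒵 : Type*} [Category 𝒴] [Category 𝒵] {p : 𝒴 ⥤ Sch k} {q : 𝒵 ⥤ Sch k}
    (F : 𝒴 ⥤ 𝒵) (e : p ⟶ F ⋙ q) : Points p → Points q :=
  Quot.map (fun a => ⟨F.obj a.1, (e.app a.1).left a.2⟩) (by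
    rintro ⟨y, s⟩ ⟨z, t⟩ ⟨g : y ⟶ z, hg : (p.map g).left s = t⟩
    refine ⟨F.map g, ?_⟩
    have h := congrArg (fun m => CommaMorphism.left m) (e.naturality g)
    exact (congrArg (fun m : (p.obj y).left ⟶ (q.obj (F.obj z)).left => m s) h).symm.trans
      (congrArg (e.app z).left hg))

/-- The source is a quotient of a disjoint union, so continuity is tested on each object `y`, where
the map is the scheme morphism `e.app y` followed by the map to points given by `F.obj y`. -/
lemma Points.continuous_map {𝒴 𝒵 : Type*} [Category 𝒴] [Category 𝒵] {p : 𝒴 ⥤ Sch k}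
    {q : 𝒵 ⥤ Sch k} (F : 𝒴 ⥤ 𝒵) (e : p ⟶ F ⋙ q) : Continuous (Points.map F e) := by
  refine continuous_quot_lift _ (continuous_sigma fun y => ?_)
  exact (Points.continuous_mk q (F.obj y)).comp (e.app y).left.continuous

/-- The restriction of an object of the moduli stack along a morphism of `K`-schemes. -/
def Bun.restrict (E : Bun K X G) {V : Over (specK k K)} (f : V ⟶ E.U) : Bun K X G :=
  ⟨V, E.bundle.pullback ((timesCurve K X).map f)⟩

/-- The canonical morphism from the restriction of an object. -/
def Bun.restrictHom (E : Bun K X G) {V : Over (specK k K)} (f : V ⟶ E.U) : E.restrict f ⟶ E :=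
  Bun.Hom.mk f (E.bundle.pullbackProj _) rfl

/-- The isomorphisms `g^* (f^* E) ≅ (g ≫ f)^* E` are natural in the object `E` of the moduli
stack. -/
lemma Bun.pullbackCompIso_naturality {Φ : Over (specK k K) ⥤ Over (specK k K)}
    (f : Φ ⋙ timesCurve K X ⟶ timesCurve K X) {E E' : Bun K X G} (m : E ⟶ E') {R R' : Sch k}
    {c : R ⟶ R'} {g : R ⟶ (timesCurve K X).obj (Φ.obj E.U)}
    {g' : R' ⟶ (timesCurve K X).obj (Φ.obj E'.U)} {h : R ⟶ (timesCurve K X).obj E.U}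
    {h' : R' ⟶ (timesCurve K X).obj E'.U} (w : g ≫ f.app E.U = h) (w' : g' ≫ f.app E'.U = h')
    (hc : g ≫ BG.Hom.base (Bun.Hom.map ((Bun.pullbackAlong Φ f).map m)) = c ≫ g')
    (hm : h ≫ BG.Hom.base (Bun.Hom.map m) = c ≫ h') :
    Torsor.pullbackMap (Bun.Hom.map ((Bun.pullbackAlong Φ f).map m)) g g' c hc ≫
        (E'.bundle.pullbackCompIso (f.app E'.U) g' h' w').hom =
      (E.bundle.pullbackCompIso (f.app E.U) g h w).hom ≫
        Torsor.pullbackMap (Bun.Hom.map m) h h' c hm :=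
  Torsor.pullbackCompIso_naturality _ _ _ _ _
    -- The bundle map underlying `m` lies over `timesCurve.map` of its base, so the square required
    -- here is the naturality square of `f`.
    ((congrArg _ (Bun.Hom.map_base m)).trans (f.naturality _).symm) _ _

lemma graph_fst {U : Over (specK k K)} (x : U ⟶ baseChange K X) :
    graph x ≫ timesCurve.fst U = x.left :=
  timesCurve.lift_fst _ _ _

lemma graph_snd {U : Over (specK k K)} (x : U ⟶ baseChange K X) :
    graph x ≫ timesCurve.snd U = 𝟙 U.left :=
  timesCurve.lift_snd _ _ _

/-- Every connected component of the moduli stack contains an object over the spectrum of a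
field. -/
lemma exists_inComponent (θ : Component K X G) :
    ∃ E : Bun K X G, inComponent θ E ∧ Nonempty E.U.left.left := by
  obtain ⟨x, rfl⟩ := ConnectedComponents.surjective_coe θ
  obtain ⟨⟨E, (s : E.U.left.left)⟩, rfl⟩ := Quot.exists_rep x
  let S : Scheme.{u} := E.U.left.left
  let i : Spec (S.residueField s) ⟶ S := S.fromSpecResidueField s
  -- The residue field spectrum at `s` inherits its structures over `k` and `K` from `U`.
  let V : Over (specK k K) :=
    Over.mk (Over.homMk i rfl ≫ E.U.hom : Over.mk (i ≫ E.U.left.hom) ⟶ specK k K)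
  let f : V ⟶ E.U := Over.homMk (Over.homMk i rfl) rfl
  refine ⟨E.restrict f, fun t => ?_, ⟨IsLocalRing.closedPoint (S.residueField s)⟩⟩
  -- Every point of the spectrum maps to `s`, so the restriction morphism identifies its class with
  -- that of `(E, s)`, which lies in the chosen component.
  refine congrArg _ (Quot.sound ⟨E.restrictHom f, ?_⟩)
  exact S.fromSpecResidueField_apply s t

/-- An endofunctor of the moduli stack which does not change the parameter schemes as `k`-schemes
maps every connected component into a unique connected component. -/
lemma existsUnique_mapsComponent (F : Bun K X G ⥤ Bun K X G)
    (e : Bun.toK K X G ⋙ Over.forget _ ≅ F ⋙ Bun.toK K X G ⋙ Over.forget _)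
    (θ : Component K X G) : ∃! θ' : Component K X G, MapsComponent F θ θ' := by
  have hc : Continuous (Points.map F e.hom) := Points.continuous_map F e.hom
  let θ₁ : Component K X G := hc.connectedComponentsMap θ
  have key : MapsComponent F θ θ₁ := by
    intro E hE s
    -- Membership in `θ₁` concerns every point of the new parameter scheme. Invertibility of `e`
    -- makes each of them the image of a point of the old one, whose component is known to be `θ`.
    have h : (e.hom.app E).left ((e.inv.app E).left s) = s := by
      have h := congrArg (fun m => CommaMorphism.left m) (e.inv_hom_id_app E)
      exact congrArg
        (fun m : (F.obj E).U.left.left ⟶ (F.obj E).U.left.left => m s) h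
    have h₁ := congrArg hc.connectedComponentsMap (hE ((e.inv.app E).left s))
    refine Eq.trans ?_ h₁
    exact congrArg (fun t : (F.obj E).U.left.left =>
      (ConnectedComponents.mk (Quot.mk _ ⟨F.obj E, t⟩) : Component K X G)) h.symm
  refine ⟨θ₁, key, fun θ' h => ?_⟩
  -- Objects over the empty scheme lie in every component and cannot separate `θ'` from `θ₁`; one
  -- point of a nonempty object does.
  obtain ⟨E, hE, ⟨s⟩⟩ := exists_inComponent θ
  let s' : (F.obj E).U.left.left := (e.hom.app E).left s
  exact (h E hE s').symm.trans (key E hE s')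

end Components

/-! ### Graphs, Frobenius and the universal bundle -/

section Naturality

/-- Both composites are the map `(x, g)` to `X_K ×_K V`. This supplies the commuting squares needed
for naturality along morphisms of the product stack. -/
lemma graph_comp_map {k : Type u} [Field k] {K : Type u} [Field K] [Algebra k K] {X : Sch k}
    {U V : Over (specK k K)} (g : U ⟶ V) {x : U ⟶ baseChange K X} {y : V ⟶ baseChange K X}
    (w : g ≫ y = x) : graph x ≫ (timesCurve K X).map g = g.left ≫ graph y := by
  subst w
  apply timesCurve.hom_ext <;> simp [graph]

variable {k : Type u} [Field k] [Fintype k] {K : Type u} [Field K] [Algebra k K] {X G : Sch k}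
  [GrpObj G]

/-- Both sides have components `Frob_X ∘ x` and the identity of `U`. The points `x` and `y` are
linear for different `K`-structures on the same `k`-scheme, so they are compared through their
underlying morphisms. -/
lemma graph_comp_arithFrobTimes [Algebra.IsAlgebraic k K] {U : Over (specK k K)}
    (x : (Over.map (frobSpec k K).inv).obj U ⟶ baseChange K X) (y : U ⟶ baseChange K X)
    (e : x.left ≫ arithFrob K X = y.left) :
    graph x ≫ (arithFrobTimes K X).app U = graph y := by
  have h₁ : (arithFrobTimes K X).app U ≫ timesCurve.fst U =
      timesCurve.fst ((Over.map (frobSpec k K).inv).obj U) ≫ arithFrob K X :=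
    timesCurve.lift_fst _ _ _
  have h₂ : (arithFrobTimes K X).app U ≫ timesCurve.snd U =
      timesCurve.snd ((Over.map (frobSpec k K).inv).obj U) :=
    timesCurve.lift_snd _ _ _
  apply timesCurve.hom_ext
  · refine (Category.assoc _ _ _).trans ((congrArg _ h₁).trans ?_)
    refine (Category.assoc _ _ _).symm.trans ?_
    exact ((congrArg (· ≫ arithFrob K X) (graph_fst x)).trans e).trans (graph_fst y).symm
  · refine (Category.assoc _ _ _).trans ((congrArg _ h₂).trans ?_)
    exact (graph_snd x).trans (graph_snd y).symm

/-- The universal bundle is compatible with the arithmetic Frobenius. -/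
def arithNaturality [Algebra.IsAlgebraic k K] {θ θ' : Component K X G}
    (h : MapsComponent (psi K X G) θ θ') :
    GBundle.pullback (arithFrobTimesId θ) (univBundleComp θ) ≅
      GBundle.pullback (idTimesPsi h) (univBundleComp θ') :=
  -- The canonical isomorphism runs from the iterated pullback, on the `ψ` side, to the single
  -- pullback, on the `Frob_X` side.
  Iso.symm <| GBundle.isoMk _ _
    (fun A => Torsor.pullbackCompIso A.left.obj.bundle
      ((arithFrobTimes K X).app A.left.obj.U)
      (graph (((idTimesPsi h).obj A).hom))
      (graph (((arithFrobTimesId θ).obj A).hom))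
      (graph_comp_arithFrobTimes _ _ rfl))
    (fun _ => Torsor.isHomLift_pullbackCompIso _ _ _ _
      (graph_comp_arithFrobTimes _ _ rfl))
    (fun m => Bun.pullbackCompIso_naturality (G := G) (arithFrobTimes K X) m.left.hom _ _
      -- Two squares of graphs are needed: this one for the points `x`, regarded as maps from the
      -- twisted parameter schemes, and the next for the points `Frob_X ∘ x`.
      (graph_comp_map _ (CostructuredArrow.w ((idTimesPsi h).map m)))
      ((congrArg _ (Bun.Hom.map_base m.left.hom)).trans
        (graph_comp_map _ (CostructuredArrow.w ((arithFrobTimesId θ).map m)))))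

/-- The geometric Frobenius is `K`-linear, so no twist of `U` occurs; both sides are again `(F ∘ x,
id)`. -/
lemma graph_comp_geomFrobTimes {U : Over (specK k K)}
    (x : U ⟶ baseChange K X) (y : U ⟶ baseChange K X)
    (e : x.left ≫ geomFrob K X = y.left) :
    graph x ≫ (geomFrobTimes K X).app U = graph y := by
  have h₁ : (geomFrobTimes K X).app U ≫ timesCurve.fst U =
      timesCurve.fst U ≫ geomFrob K X :=
    timesCurve.lift_fst _ _ _
  have h₂ : (geomFrobTimes K X).app U ≫ timesCurve.snd U =
      timesCurve.snd U :=
    timesCurve.lift_snd _ _ _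
  apply timesCurve.hom_ext
  · refine (Category.assoc _ _ _).trans ((congrArg _ h₁).trans ?_)
    refine (Category.assoc _ _ _).symm.trans ?_
    exact ((congrArg (· ≫ geomFrob K X) (graph_fst x)).trans e).trans (graph_fst y).symm
  · refine (Category.assoc _ _ _).trans ((congrArg _ h₂).trans ?_)
    exact (graph_snd x).trans (graph_snd y).symm

/-- The universal bundle is compatible with the geometric Frobenius. -/
def geomNaturality {θ θ' : Component K X G} (h : MapsComponent (phi K X G) θ θ') :
    GBundle.pullback (geomFrobTimesId θ) (univBundleComp θ) ≅
      GBundle.pullback (idTimesPhi h) (univBundleComp θ') :=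
  Iso.symm <| GBundle.isoMk _ _
    (fun A => Torsor.pullbackCompIso A.left.obj.bundle
      ((geomFrobTimes K X).app A.left.obj.U)
      (graph (((idTimesPhi h).obj A).hom))
      (graph (((geomFrobTimesId θ).obj A).hom))
      (graph_comp_geomFrobTimes _ _ rfl))
    (fun _ => Torsor.isHomLift_pullbackCompIso _ _ _ _
      (graph_comp_geomFrobTimes _ _ rfl))
    (fun m => Bun.pullbackCompIso_naturality (G := G) (geomFrobTimes K X) m.left.hom _ _
      (graph_comp_map _ (CostructuredArrow.w ((idTimesPhi h).map m)))
      ((congrArg _ (Bun.Hom.map_base m.left.hom)).trans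
        (graph_comp_map _ (CostructuredArrow.w ((geomFrobTimesId θ).map m)))))

end Naturality

end FrobBun

end

theorem proposition2p1 {k : Type u} [Field k] [Fintype k] (K : Type u) [Field K] [Algebra k K]
    [IsAlgClosure k K]
    (X : Over (Spec (CommRingCat.of k))) [SmoothOfRelativeDimension 1 X.hom] [IsProper X.hom]
    [GeometricallyConnected X.hom]
    (G : Over (Spec (CommRingCat.of k))) [GrpObj G] [IsAffineHom G.hom] [Smooth G.hom] :
    ((∀ θ : FrobBun.Component K X G, ∃! θ' : FrobBun.Component K X G,
        FrobBun.MapsComponent (FrobBun.psi K X G) θ θ') ∧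
      ∀ (θ θ' : FrobBun.Component K X G)
        (h : FrobBun.MapsComponent (FrobBun.psi K X G) θ θ'),
        Nonempty
          (FrobBun.GBundle.pullback (FrobBun.arithFrobTimesId θ) (FrobBun.univBundleComp θ) ≅
            FrobBun.GBundle.pullback (FrobBun.idTimesPsi h) (FrobBun.univBundleComp θ'))) ∧
    ((∀ θ : FrobBun.Component K X G, ∃! θ' : FrobBun.Component K X G,
        FrobBun.MapsComponent (FrobBun.phi K X G) θ θ') ∧
      ∀ (θ θ' : FrobBun.Component K X G)
        (h : FrobBun.MapsComponent (FrobBun.phi K X G) θ θ'),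
        Nonempty
          (FrobBun.GBundle.pullback (FrobBun.geomFrobTimesId θ) (FrobBun.univBundleComp θ) ≅
            FrobBun.GBundle.pullback (FrobBun.idTimesPhi h) (FrobBun.univBundleComp θ'))) := by
  have : Algebra.IsAlgebraic k K := IsAlgClosure.isAlgebraic
  -- The identity serves as comparison because changing the structure morphism to `Spec K` does not
  -- affect the underlying `k`-scheme.
  exact ⟨⟨FrobBun.existsUnique_mapsComponent _ (Iso.refl _),
      fun _ _ h => ⟨FrobBun.arithNaturality h⟩⟩,
    FrobBun.existsUnique_mapsComponent _ (Iso.refl _),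
      fun _ _ h => ⟨FrobBun.geomNaturality h⟩⟩
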